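/- Let $p$ be a prime and let $R$ be an F-finite reduced Noetherian commutative ring of characteristic $p$ (F-finite: the Frobenius $F\colon R\to R$, $x\mapsto x^p$, makes $R$ a finitely generated $R$-module). Let $R^\circ$ be the set of elements of $R$ that lie in no minimal prime ideal. A *graded family* $\mathfrak a_\bullet=\{\mathfrak a_m\}_{m\ge 1}$ of ideals of $R$ is a collection of ideals with $\mathfrak a_1\cap R^\circ\neq\emptyset$ and $\mathfrak a_k\mathfrak a_l\subseteq\mathfrak a_{k+l}$ for all $k,l\ge 1$; put $\mathfrak a_0=R$. For graded families $\mathfrak a_\bullet,\mathfrak b_\bullet$, the graded family $\mathfrak a_\bullet+\mathfrak b_\bullet$ is given by $(\mathfrak a_\bullet+\mathfrak b_\bullet)_m=\sum_{k+l=m,\ k,l\ge 0}\mathfrak a_k\mathfrak b_l$. Let $E=\bigoplus_{\mathfrak m}E_R(R/\mathfrak m)$ be the direct sum, over all maximal ideals $\mathfrak m$ of $R$, of the injective hulls of the residue fields. For $q=p^e$ let ${}^eR$ be $R$ viewed as an $R$-algebra via $F^e$, and for $z\in E$ let $z^q=1\otimes z\in \mathbb F^e(E)={}^eR\otimes_R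 E$, where $R$ acts on $\mathbb F^e(E)$ by multiplication on ${}^eR=R$. For real $t>0$ let $0_E^{*\mathfrak a_\bullet^t}$ be the set of $z\in E$ for which there is $c\in R^\circ$ with $c\,\mathfrak a_{\lceil tq\rceil}z^q=0$ for all large $q=p^e$. For real $\lambda,\mu\ge 0$ let $0_E^{*\mathfrak a_\bullet^\lambda\mathfrak b_\bullet^\mu}$ be the set of $z\in E$ for which there is $c\in R^\circ$ with $c\,\mathfrak a_{\lceil \lambda q\rceil}\mathfrak b_{\lceil\mu q\rceil}z^q=0$ for all large $q=p^e$. These are submodules of $E$; put $$\widetilde\tau(\mathfrak a_\bullet^t)=\operatorname{Ann}_R\bigl(0_E^{*\mathfrak a_\bullet^t}\bigr),\qquad \widetilde\tau(\mathfrak a_\bullet^\lambda\mathfrak b_\bullet^\mu)=\operatorname{Ann}_R\bigl(0_E^{*\mathfrak a_\bullet^\lambda\mathfrak b_\bullet^\mu}\bigr).$$ **Proposition.** For all graded families $\mathfrak a_\bullet,\mathfrak b_\bullet$ of ideals of $R$ and every real number $t>0$, $$\widetilde\tau\bigl((\mathfrak a_\bullet+\mathfrak b_\bullet)^t\bigr)=\sum_{\substack{\lambda,\mu\in\mathbb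 R_{\ge 0}\\ \lambda+\mu=t}}\widetilde\tau\bigl(\mathfrak a_\bullet^\lambda\mathfrak b_\bullet^\mu\bigr).$$ -/

import Mathlib

open scoped TensorProduct DirectSum

universe u

namespace AsymptoticTestIdeal

section InjectiveHull

variable (R : Type u) [CommRing R]

/-- `i : M → E` exhibits `E` as an injective hull of `M`: it is an injective map into an
injective module, and `E` is an essential extension of the image of `i`. -/
structure IsInjectiveHull {M E : Type u} [AddCommGroup M] [Module R M]
    [AddCommGroup E] [Module R E] (i : M →ₗ[R] E) : Prop where
  injective_map : Function.Injective i
  injective_module : Module.Injective R E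
  essential : ∀ K : Submodule R E, K ⊓ LinearMap.range i = ⊥ → K = ⊥

/-- Every module has an injective hull. -/
theorem exists_isInjectiveHull (M : Type u) [AddCommGroup M] [Module R M] :
    ∃ (E : Type u) (_ : AddCommGroup E) (_ : Module R E) (i : M →ₗ[R] E),
      IsInjectiveHull R i := by
  classical
  obtain ⟨I, _, _, hI, f, hf⟩ : ∃ (I : Type u) (_ : AddCommGroup I) (_ : Module R I)
      (_ : Module.Injective R I) (f : M →ₗ[R] I), Function.Injective f := by
    obtain ⟨J⟩ := CategoryTheory.EnoughInjectives.presentation (ModuleCat.of R M)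
    exact ⟨J.J, inferInstance, inferInstance,
      (Module.injective_iff_injective_object R J.J).2 J.injective,
      J.f.hom, (ModuleCat.mono_iff_injective J.f).1 J.mono⟩
  set P := LinearMap.range f with hP
  -- a maximal essential extension `N` of `P` inside `I`
  obtain ⟨N, hPN, hN⟩ := zorn_le_nonempty₀
    {N : Submodule R I | P ≤ N ∧ ∀ K ≤ N, K ⊓ P = ⊥ → K = ⊥} (by
      intro c hc hchain y hy
      refine ⟨sSup c, ⟨(hc hy).1.trans (le_sSup hy), fun K hK hKP => ?_⟩,
        fun z hz => le_sSup hz⟩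
      rw [eq_bot_iff]
      intro x hx
      obtain ⟨L, hL, hxL⟩ := (Submodule.mem_sSup_of_directed ⟨y, hy⟩ hchain.directedOn).1 (hK hx)
      have hspan : Submodule.span R {x} = ⊥ := by
        refine (hc hL).2 _ ((Submodule.span_singleton_le_iff_mem _ _).2 hxL) ?_
        rw [eq_bot_iff, ← hKP]
        exact inf_le_inf_right _ ((Submodule.span_singleton_le_iff_mem _ _).2 hx)
      rw [← hspan]
      exact Submodule.mem_span_singleton_self x) P
    ⟨le_rfl, fun K hK h => by rwa [inf_eq_left.2 hK] at h⟩
  -- a maximal submodule `C` with `C ⊓ N = ⊥`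
  obtain ⟨C, -, hC⟩ := zorn_le_nonempty₀ {C : Submodule R I | C ⊓ N = ⊥} (by
      intro c hc hchain y hy
      refine ⟨sSup c, ?_, fun z hz => le_sSup hz⟩
      change sSup c ⊓ N = ⊥
      rw [eq_bot_iff]
      rintro x ⟨hx, hxN⟩
      obtain ⟨L, hL, hxL⟩ := (Submodule.mem_sSup_of_directed ⟨y, hy⟩ hchain.directedOn).1 hx
      have h0 : L ⊓ N = ⊥ := hc hL
      rw [← h0]
      exact ⟨hxL, hxN⟩) ⊥ (by simp)
  have hC0 : C ⊓ N = ⊥ := hC.1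
  have hCmax : ∀ D : Submodule R I, C ≤ D → D ⊓ N = ⊥ → D ≤ C := fun D h1 h2 => hC.2 h2 h1
  obtain ⟨h, hh⟩ := hI.out (C.mkQ ∘ₗ N.subtype) (by
    rw [← LinearMap.ker_eq_bot, eq_bot_iff]
    rintro ⟨x, hx⟩ hxk
    have hxC : x ∈ C := by simpa using hxk
    have : x ∈ C ⊓ N := ⟨hxC, hx⟩
    rw [hC0] at this
    simpa using this) N.subtype
  set ψ : I →ₗ[R] I := h ∘ₗ C.mkQ with hψ
  have hψN : ∀ x ∈ N, ψ x = x := fun x hx => hh ⟨x, hx⟩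
  have hψC : ∀ x ∈ C, ψ x = 0 := fun x hx => by
    simp [hψ, (Submodule.Quotient.mk_eq_zero C).2 hx]
  have hNr : N ≤ LinearMap.range ψ := fun x hx => ⟨x, hψN x hx⟩
  have hess : ∀ L ≤ LinearMap.range ψ, L ⊓ N = ⊥ → L = ⊥ := by
    intro L hL hLN
    have hle : L.comap ψ ≤ C := by
      apply hCmax
      · intro x hx
        rw [Submodule.mem_comap, hψC x hx]
        exact L.zero_mem
      · rw [eq_bot_iff]
        rintro x ⟨hx, hxN⟩
        rw [SetLike.mem_coe, Submodule.mem_comap, hψN x hxN] at hx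
        rw [← hLN]
        exact ⟨hx, hxN⟩
    rw [eq_bot_iff]
    intro x hx
    obtain ⟨y, rfl⟩ := hL hx
    exact (Submodule.mem_bot R).2 (hψC y (hle hx))
  have hrN : LinearMap.range ψ ≤ N := by
    refine hN.2 ⟨hPN.trans hNr, fun K hK hKP => ?_⟩ hNr
    refine hess K hK (hN.1.2 _ inf_le_right ?_)
    rw [eq_bot_iff, ← hKP]
    exact inf_le_inf_right _ inf_le_left
  refine ⟨N, inferInstance, inferInstance, f.codRestrict N (fun x => hPN ⟨x, rfl⟩),
    ⟨fun x y hxy => hf (congrArg Subtype.val hxy), ⟨?_⟩, ?_⟩⟩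
  · intro X Y _ _ _ _ j hj g
    obtain ⟨k, hk⟩ := hI.out j hj (N.subtype ∘ₗ g)
    refine ⟨(ψ.codRestrict N fun x => hrN ⟨x, rfl⟩) ∘ₗ k, fun x => Subtype.ext ?_⟩
    change ψ (k (j x)) = g x
    rw [hk x]
    exact hψN _ (g x).2
  · intro K hK
    have hmap : K.map N.subtype = ⊥ := by
      refine hN.1.2 _ (Submodule.map_subtype_le N K) ?_
      rw [eq_bot_iff]
      rintro _ ⟨⟨x, hx, rfl⟩, ⟨m, hm⟩⟩
      have hxK : x ∈ K ⊓ LinearMap.range (f.codRestrict N (fun x => hPN ⟨x, rfl⟩)) :=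
        ⟨hx, ⟨m, Subtype.ext hm⟩⟩
      rw [hK, Submodule.mem_bot] at hxK
      simp [hxK]
    exact Submodule.map_injective_of_injective N.injective_subtype (by rw [hmap, Submodule.map_bot])

variable (M : Type u) [AddCommGroup M] [Module R M]

/-- The injective hull `E_R(M)` of an `R`-module `M` (unique up to isomorphism; a choice of it). -/
noncomputable def InjHull : Type u := (exists_isInjectiveHull R M).choose

noncomputable instance : AddCommGroup (InjHull R M) :=
  (exists_isInjectiveHull R M).choose_spec.choose

noncomputable instance : Module R (InjHull R M) :=
  (exists_isInjectiveHull R M).choose_spec.choose_spec.choose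

/-- The embedding of `M` into its injective hull. -/
noncomputable def InjHull.ι : M →ₗ[R] InjHull R M :=
  (exists_isInjectiveHull R M).choose_spec.choose_spec.choose_spec.choose

theorem InjHull.isInjectiveHull : IsInjectiveHull R (InjHull.ι R M) :=
  (exists_isInjectiveHull R M).choose_spec.choose_spec.choose_spec.choose_spec

/-- `E = ⨁_𝔪 E_R(R/𝔪)`, the direct sum over all maximal ideals of `R` of the injective hulls
of the residue fields. -/
abbrev ResidueHull : Type u :=
  ⨁ 𝔪 : MaximalSpectrum R, InjHull R (R ⧸ 𝔪.asIdeal)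

end InjectiveHull

/-- `R°`: the elements of `R` that lie in no minimal prime ideal, as a multiplicative set. -/
def ringCirc (R : Type u) [CommRing R] : Submonoid R where
  carrier := {c | ∀ P ∈ minimalPrimes R, c ∉ P}
  one_mem' := fun P hP h => hP.1.1.ne_top ((Ideal.eq_top_iff_one P).2 h)
  mul_mem' := fun ha hb P hP h => (hP.1.1.mem_or_mem h).elim (ha P hP) (hb P hP)

section Frobenius

variable (R : Type u) [CommRing R] (p : ℕ) [Fact p.Prime] [CharP R p]

/-- `R` is F-finite: the Frobenius `x ↦ x ^ p` makes `R` a finitely generated `R`-module. -/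
def IsFFinite : Prop := (frobenius R p).Finite

/-- `ᵉR`: the ring `R`, regarded as an `R`-algebra through the iterated Frobenius
`x ↦ x ^ (p ^ e)`. -/
@[nolint unusedArguments]
def FrobeniusRing (R : Type u) (_p _e : ℕ) : Type u := R

instance (e : ℕ) : CommRing (FrobeniusRing R p e) := inferInstanceAs (CommRing R)

noncomputable instance (e : ℕ) : Algebra R (FrobeniusRing R p e) :=
  (iterateFrobenius R p e).toAlgebra

/-- The identity map `R → ᵉR`, an isomorphism of rings (not of `R`-modules). -/
def toFrob (e : ℕ) : R ≃+* FrobeniusRing R p e := RingEquiv.refl R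

theorem algebraMap_frobeniusRing (e : ℕ) (r : R) :
    algebraMap R (FrobeniusRing R p e) r = toFrob R p e (r ^ p ^ e) := rfl

/-- The Frobenius (Peskine-Szpiro) functor `𝔽ᵉ(M) = ᵉR ⊗_R M`. Its `R`-module structure is the one
coming from `ᵉR = R`, that is, from multiplication on the left tensor factor. -/
abbrev FrobeniusPullback (e : ℕ) (M : Type u) [AddCommGroup M] [Module R M] : Type u :=
  FrobeniusRing R p e ⊗[R] M

variable {M : Type u} [AddCommGroup M] [Module R M]

/-- For `x : R` and `z : M`, the element `x z^q` of `𝔽ᵉ(M)`, where `q = p ^ e` and `z^q = 1 ⊗ z` is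
the image of `z` under the iterated Frobenius map `M → 𝔽ᵉ(M)`. -/
noncomputable def mulPow (e : ℕ) (x : R) (z : M) : FrobeniusPullback R p e M :=
  toFrob R p e x • ((1 : FrobeniusRing R p e) ⊗ₜ[R] z)

theorem mulPow_eq (e : ℕ) (x : R) (z : M) : mulPow R p e x z = toFrob R p e x ⊗ₜ[R] z := by
  simp [mulPow, TensorProduct.smul_tmul']

theorem mulPow_mul (e : ℕ) (y x : R) (z : M) :
    mulPow R p e (y * x) z = toFrob R p e y • mulPow R p e x z := by
  simp [mulPow, mul_smul]

theorem mulPow_smul (e : ℕ) (x r : R) (z : M) :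
    mulPow R p e x (r • z) = toFrob R p e (r ^ p ^ e) • mulPow R p e x z := by
  rw [mulPow_eq, mulPow_eq, TensorProduct.tmul_smul, TensorProduct.smul_tmul',
    TensorProduct.smul_tmul', Algebra.smul_def, algebraMap_frobeniusRing, smul_eq_mul]

/-- The tight closure of the zero submodule of `M` with respect to a sequence of ideals
`(J_e)_{e ≥ 0}`: the submodule of all `z ∈ M` for which there is `c ∈ R°` with
`c J_e z^q = 0` in `𝔽ᵉ(M)` for all large `q = p ^ e`. -/
noncomputable def zeroTightClosure (J : ℕ → Ideal R) (M : Type u) [AddCommGroup M] [Module R M] :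
    Submodule R M where
  carrier := {z | ∃ c ∈ ringCirc R, ∃ e₀ : ℕ, ∀ e ≥ e₀, ∀ x ∈ J e, mulPow R p e (c * x) z = 0}
  zero_mem' := ⟨1, one_mem _, 0, fun e _ x _ => by simp [mulPow]⟩
  add_mem' := by
    rintro z w ⟨c, hc, e₀, hz⟩ ⟨d, hd, e₁, hw⟩
    refine ⟨c * d, mul_mem hc hd, max e₀ e₁, fun e he x hx => ?_⟩
    have h1 : mulPow R p e (c * d * x) z = 0 := by
      rw [show c * d * x = d * (c * x) by ring, mulPow_mul,
        hz e (le_of_max_le_left he) x hx, smul_zero]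
    have h2 : mulPow R p e (c * d * x) w = 0 := by
      rw [show c * d * x = c * (d * x) by ring, mulPow_mul,
        hw e (le_of_max_le_right he) x hx, smul_zero]
    rw [mulPow_eq] at h1 h2 ⊢
    rw [TensorProduct.tmul_add, h1, h2, add_zero]
  smul_mem' := by
    rintro r z ⟨c, hc, e₀, hz⟩
    exact ⟨c, hc, e₀, fun e he x hx => by rw [mulPow_smul, hz e he x hx, smul_zero]⟩

end Frobenius

/-- A graded family of ideals `𝔞_• = {𝔞_m}`: `𝔞_1` meets `R°` and `𝔞_k 𝔞_l ⊆ 𝔞_{k+l}`,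
with the convention `𝔞_0 = R`. -/
structure GradedFamily (R : Type u) [CommRing R] where
  ideal : ℕ → Ideal R
  ideal_zero : ideal 0 = ⊤
  exists_mem_one : ∃ x ∈ ideal 1, x ∈ ringCirc R
  mul_le : ∀ k l : ℕ, 1 ≤ k → 1 ≤ l → ideal k * ideal l ≤ ideal (k + l)

namespace GradedFamily

variable {R : Type u} [CommRing R]

theorem mul_le' (𝔞 : GradedFamily R) (k l : ℕ) : 𝔞.ideal k * 𝔞.ideal l ≤ 𝔞.ideal (k + l) := by
  rcases Nat.eq_zero_or_pos k with rfl | hk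
  · rw [zero_add, 𝔞.ideal_zero, Ideal.top_mul]
  rcases Nat.eq_zero_or_pos l with rfl | hl
  · rw [add_zero, 𝔞.ideal_zero, Ideal.mul_top]
  exact 𝔞.mul_le k l hk hl

/-- The graded family `𝔞_• + 𝔟_•`, with `(𝔞_• + 𝔟_•)_m = ∑_{k+l=m} 𝔞_k 𝔟_l`, where `k, l ≥ 0`. -/
instance : Add (GradedFamily R) where
  add 𝔞 𝔟 :=
    { ideal := fun m => ∑ kl ∈ Finset.HasAntidiagonal.antidiagonal m, 𝔞.ideal kl.1 * 𝔟.ideal kl.2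
      ideal_zero := by simp [𝔞.ideal_zero, 𝔟.ideal_zero]
      exists_mem_one := by
        obtain ⟨x, hx, hx'⟩ := 𝔞.exists_mem_one
        refine ⟨x, ?_, hx'⟩
        rw [Ideal.sum_eq_sup]
        refine Finset.le_sup (f := fun kl : ℕ × ℕ => 𝔞.ideal kl.1 * 𝔟.ideal kl.2)
          (b := ((1, 0) : ℕ × ℕ)) (by simp) ?_
        simpa [𝔟.ideal_zero] using hx
      mul_le := by
        intro m n _ _
        rw [Finset.sum_mul_sum, Ideal.sum_eq_sup]
        refine Finset.sup_le fun i hi => ?_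
        rw [Ideal.sum_eq_sup]
        refine Finset.sup_le fun j hj => ?_
        rw [Finset.HasAntidiagonal.mem_antidiagonal] at hi hj
        rw [Ideal.sum_eq_sup, mul_mul_mul_comm]
        refine (Ideal.mul_mono (𝔞.mul_le' _ _) (𝔟.mul_le' _ _)).trans ?_
        exact Finset.le_sup (f := fun kl : ℕ × ℕ => 𝔞.ideal kl.1 * 𝔟.ideal kl.2)
          (b := (i.1 + j.1, i.2 + j.2)) (by rw [Finset.HasAntidiagonal.mem_antidiagonal]; omega) }

theorem add_ideal (𝔞 𝔟 : GradedFamily R) (m : ℕ) :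
    (𝔞 + 𝔟).ideal m = ∑ kl ∈ Finset.HasAntidiagonal.antidiagonal m, 𝔞.ideal kl.1 * 𝔟.ideal kl.2 := rfl

end GradedFamily

section TestIdeal

variable {R : Type u} [CommRing R] (p : ℕ) [Fact p.Prime] [CharP R p]

/-- `τ̃(𝔞_•^t) = Ann_R(0_E^{*𝔞_•^t})`, where `z ∈ 0_E^{*𝔞_•^t}` means that there is `c ∈ R°` with
`c 𝔞_{⌈tq⌉} z^q = 0` for all large `q = p ^ e`. -/
noncomputable def testIdeal (𝔞 : GradedFamily R) (t : ℝ) : Ideal R :=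
  (zeroTightClosure R p (fun e => 𝔞.ideal ⌈t * (p : ℝ) ^ e⌉₊) (ResidueHull R)).annihilator

/-- The mixed ideal `τ̃(𝔞_•^s 𝔟_•^t) = Ann_R(0_E^{*𝔞_•^s 𝔟_•^t})`, where `z ∈ 0_E^{*𝔞_•^s 𝔟_•^t}`
means that there is `c ∈ R°` with `c 𝔞_{⌈sq⌉} 𝔟_{⌈tq⌉} z^q = 0` for all large `q = p ^ e`. -/
noncomputable def mixedTestIdeal (𝔞 𝔟 : GradedFamily R) (s t : ℝ) : Ideal R :=
  (zeroTightClosure R p (fun e => 𝔞.ideal ⌈s * (p : ℝ) ^ e⌉₊ * 𝔟.ideal ⌈t * (p : ℝ) ^ e⌉₊)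
    (ResidueHull R)).annihilator

end TestIdeal

end AsymptoticTestIdeal

/-! Write `𝒞ₑ(I)` for the image of an ideal `I` under all `p⁻ᵉ`-linear maps `R → R`. Since `ᵉR` is
finitely presented and `E = ⨁ E_R(R/𝔪)` is a sum of injectives, `d J_e z^q = 0` if and only if
`𝒞ₑ(d J_e) z = 0`. As `E` is a cogenerator, the annihilator of `0_E^{*J}` is therefore the
intersection over all `d ∈ R°` and `e₀` of the ideals `∑_{e ≥ e₀} 𝒞ₑ(d J_e)`. An `R`-module becomes
projective over the total quotient ring of `R`, and together with Krull's intersection theorem this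
yields a `c ∈ R°` that lies, for every `d ∈ R°`, in `𝒞ₑ(dR)` for arbitrarily large `e`. By means of
`c` the ideal `τ̃((𝔞_• + 𝔟_•)^t)` is contained in the sum of the ideals `𝒞ₑ(c 𝔞_k 𝔟_l)` with
`k + l = ⌈tq⌉`, and `𝒞ₑ(c 𝔞_k 𝔟_l) ⊆ τ̃(𝔞_•^r 𝔟_•^s)` whenever `rq ≤ k` and `sq ≤ l`. Such `r`, `s`
with `r + s = t` exist. The reverse inclusion is `⌈rq⌉ + ⌈sq⌉ ≥ (r + s)q`. -/

namespace AsymptoticTestIdeal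

section RingCirc

variable {R : Type u} [CommRing R]

theorem ringCirc_le_nonZeroDivisors [IsReduced R] : ringCirc R ≤ nonZeroDivisors R := by
  refine fun c hc ↦ mem_nonZeroDivisors_iff_right.2 fun x hx ↦ ?_
  have hmem : x ∈ sInf (minimalPrimes R) := by
    rw [Ideal.mem_sInf]
    intro P hP
    have hxc : x * c ∈ P := hx ▸ P.zero_mem
    exact (hP.1.1.mem_or_mem hxc).resolve_right (hc P hP)
  rw [minimalPrimes, Ideal.sInf_minimalPrimes] at hmem
  exact IsNilpotent.eq_zero hmem

variable [IsNoetherianRing R]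

theorem mem_minimalPrimes_of_disjoint_ringCirc {P : Ideal R} (hP : P.IsPrime)
    (hdisj : Disjoint (ringCirc R : Set R) P) : P ∈ minimalPrimes R := by
  have hcover : (P : Set R) ⊆ ⋃ Q ∈ minimalPrimes R, (Q : Set R) := by
    intro x hx
    by_contra hx'
    exact Set.disjoint_left.1 hdisj (fun Q hQ hxQ ↦ hx' (Set.mem_biUnion hQ hxQ)) hx
  obtain ⟨Q, hQ, hPQ⟩ := (Ideal.subset_union_prime_finite
    (minimalPrimes.finite_of_isNoetherianRing R) ⊥ ⊥ fun Q hQ _ _ ↦ hQ.1.1).1 hcover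
  rwa [hPQ.antisymm (hQ.2 ⟨hP, bot_le⟩ hPQ)]

theorem krullDimLE_zero_localization_ringCirc : Ring.KrullDimLE 0 (Localization (ringCirc R)) := by
  have hmin (P : Ideal (Localization (ringCirc R))) (hP : P.IsPrime) :
      P.under R ∈ minimalPrimes R :=
    have h := (IsLocalization.isPrime_iff_isPrime_disjoint (ringCirc R) _ P).1 hP
    mem_minimalPrimes_of_disjoint_ringCirc h.1 h.2
  refine .mk₀ fun P hP ↦ ?_
  obtain ⟨M, hM, hPM⟩ := P.exists_le_maximal hP.ne_top
  have hMP : M.under R ≤ P.under R :=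
    (hmin M hM.isPrime).2 ⟨(hmin P hP).1.1, bot_le⟩ (Ideal.comap_mono hPM)
  have hMP' : M ≤ P := by
    rw [← IsLocalization.map_under (ringCirc R) _ P, ← IsLocalization.map_under (ringCirc R) _ M]
    exact Ideal.map_mono hMP
  rwa [hPM.antisymm hMP']

theorem isSemisimpleRing_localization_ringCirc [IsReduced R] :
    IsSemisimpleRing (Localization (ringCirc R)) := by
  have := krullDimLE_zero_localization_ringCirc (R := R)
  have : IsNoetherianRing (Localization (ringCirc R)) :=
    IsLocalization.isNoetherianRing (ringCirc R) _ inferInstance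
  have : IsArtinianRing (Localization (ringCirc R)) :=
    IsNoetherianRing.isArtinianRing_of_krullDimLE_zero
  have : IsReduced (Localization (ringCirc R)) :=
    isReduced_localizationPreserves (ringCirc R) _ inferInstance
  exact IsArtinianRing.isSemisimpleRing_of_isReduced _

end RingCirc

section GenericProjectivity

variable {R : Type*} [CommRing R]

theorem exists_comp_eq_smul_id_of_projective_localizedModule (S : Submonoid R) {F M : Type*}
    [AddCommGroup F] [Module R F] [AddCommGroup M] [Module R M] [Module.FinitePresentation R M]
    [Module.Projective (Localization S) (LocalizedModule S M)] (s : F →ₗ[R] M)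
    (hs : Function.Surjective s) : ∃ c ∈ S, ∃ h : M →ₗ[R] F, s ∘ₗ h = c • LinearMap.id := by
  let locF := LocalizedModule.mkLinearMap S F
  let locM := LocalizedModule.mkLinearMap S M
  obtain ⟨σ, hσ⟩ := Module.projective_lifting_property (LocalizedModule.map S s) LinearMap.id
    (LocalizedModule.map_surjective S s hs)
  obtain ⟨h, a, hh⟩ := Module.FinitePresentation.exists_lift_of_isLocalizedModule S locF
    (σ.restrictScalars R ∘ₗ locM)
  have hsplit : locM ∘ₗ (s ∘ₗ h) = locM ∘ₗ (a.1 • LinearMap.id) := by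
    ext x
    calc locM (s (h x)) = LocalizedModule.map S s (locF (h x)) := by
          simp [locM, locF, LocalizedModule.mkLinearMap_apply, LocalizedModule.map_mk]
      _ = LocalizedModule.map S s (a.1 • σ (locM x)) := congrArg _ (LinearMap.congr_fun hh x)
      _ = a.1 • locM x := by
          rw [LinearMap.map_smul_of_tower]
          exact congrArg (a.1 • ·) (LinearMap.congr_fun hσ (locM x))
      _ = locM (a.1 • x) := (map_smul locM a.1 x).symm
  obtain ⟨b, hb⟩ := Module.Finite.exists_smul_of_comp_eq_of_isLocalizedModule S locM _ _ hsplit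
  refine ⟨b.1 * a.1, mul_mem b.2 a.2, b.1 • h, ?_⟩
  rw [LinearMap.comp_smul, mul_smul]
  exact hb

end GenericProjectivity

theorem exists_dualBasis_up_to_ringCirc {R : Type u} [CommRing R] [IsNoetherianRing R]
    [IsReduced R] (M : Type*) [AddCommGroup M] [Module R M] [Module.Finite R M] :
    ∃ c ∈ ringCirc R, ∃ (n : ℕ) (v : Fin n → M) (φ : Fin n → M →ₗ[R] R),
      ∀ x, c • x = ∑ i, φ i x • v i := by
  have := isSemisimpleRing_localization_ringCirc (R := R)
  have : Module.Projective (Localization (ringCirc R)) (LocalizedModule (ringCirc R) M) :=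
    Module.projective_of_isSemisimpleRing _ _
  have : Module.FinitePresentation R M := Module.finitePresentation_of_finite R M
  obtain ⟨n, s, hs⟩ := Module.Finite.exists_fin' R M
  obtain ⟨c, hc, h, hsh⟩ :=
    exists_comp_eq_smul_id_of_projective_localizedModule (ringCirc R) s hs
  refine ⟨c, hc, n, fun i ↦ s (Pi.single i 1), fun i ↦ LinearMap.proj i ∘ₗ h, fun x ↦ ?_⟩
  calc c • x = s (h x) := (LinearMap.congr_fun hsh x).symm
    _ = s (∑ i, h x i • Pi.single i 1) := by rw [← pi_eq_sum_univ']
    _ = ∑ i, h x i • s (Pi.single i 1) := by simp only [map_sum, map_smul]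

section InjectiveModule

open scoped Matrix

universe v

variable {R : Type u} [CommRing R] {E : Type v} [AddCommGroup E] [Module R E]

theorem exists_comp_eq_of_ker_le [Small.{v} R] [Module.Injective R E] {N P : Type*}
    [AddCommGroup N] [Module R N] [AddCommGroup P] [Module R P] (T : N →ₗ[R] P) (β : N →ₗ[R] E)
    (h : LinearMap.ker T ≤ LinearMap.ker β) : ∃ f : P →ₗ[R] E, f ∘ₗ T = β := by
  obtain ⟨f, hf⟩ := Module.Injective.extension_property R E _ _ ((LinearMap.ker T).liftQ T le_rfl)
    (LinearMap.ker_eq_bot.1 (Submodule.ker_liftQ_eq_bot _ _ _ le_rfl))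
    ((LinearMap.ker T).liftQ β h)
  exact ⟨f, LinearMap.ext fun x ↦ LinearMap.congr_fun hf (Submodule.Quotient.mk x)⟩

theorem exists_eq_sum_smul_of_consistent [Small.{v} R] [Module.Injective R E] {ι κ : Type*}
    [Fintype ι] [Fintype κ] (A : Matrix ι κ R) (b : ι → E)
    (h : ∀ r : ι → R, r ᵥ* A = 0 → ∑ i, r i • b i = 0) :
    ∃ w : κ → E, ∀ i, b i = ∑ j, A i j • w j := by
  classical
  obtain ⟨f, hf⟩ := exists_comp_eq_of_ker_le A.vecMulLinear (Fintype.linearCombination R b) h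
  refine ⟨fun j ↦ f (Pi.single j 1), fun i ↦ ?_⟩
  calc b i = Fintype.linearCombination R b (Pi.single i 1) := by simp
    _ = f (Pi.single i 1 ᵥ* A) := (LinearMap.congr_fun hf _).symm
    _ = f (∑ j, A i j • Pi.single j 1) := by
        rw [Matrix.single_one_vecMul, pi_eq_sum_univ' (A.row i)]
        rfl
    _ = ∑ j, A i j • f (Pi.single j 1) := by simp only [map_sum, map_smul]

theorem exists_comp_eq_of_surjective {M N P : Type*} [AddCommGroup M] [Module R M]
    [AddCommGroup N] [Module R N] [AddCommGroup P] [Module R P] (s : N →ₗ[R] M)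
    (hs : Function.Surjective s) (φ : N →ₗ[R] P) (h : LinearMap.ker s ≤ LinearMap.ker φ) :
    ∃ φ' : M →ₗ[R] P, φ' ∘ₗ s = φ :=
  ⟨(LinearMap.ker s).liftQ φ h ∘ₗ (s.quotKerEquivOfSurjective hs).symm, by ext; simp⟩

theorem tmul_eq_zero_of_forall_dual_smul_eq_zero [Small.{v} R] [Module.Injective R E] {M : Type*}
    [AddCommGroup M] [Module R M] [Module.FinitePresentation R M] (m : M) (z : E)
    (h : ∀ φ : M →ₗ[R] R, φ m • z = 0) : m ⊗ₜ[R] z = 0 := by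
  classical
  obtain ⟨n, s, hs⟩ := Module.Finite.exists_fin' R M
  obtain ⟨v, rfl⟩ := hs m
  obtain ⟨k, a, ha⟩ :=
    Submodule.fg_iff_exists_fin_generating_family.1 (Module.FinitePresentation.fg_ker s hs)
  have hs_sum (x : Fin n → R) : s x = ∑ i, x i • s (Pi.single i 1) := by
    conv_lhs => rw [pi_eq_sum_univ' x, map_sum]
    simp only [map_smul]
  have hconsistent (r : Fin n → R) (hr : r ᵥ* Matrix.of (fun i j ↦ a j i) = 0) :
      ∑ i, r i • v i • z = 0 := by
    have hker : LinearMap.ker s ≤ LinearMap.ker (Fintype.linearCombination R r) := by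
      rw [← ha, Submodule.span_le]
      rintro _ ⟨j, rfl⟩
      have := congrFun hr j
      simpa [Matrix.vecMul, dotProduct, Fintype.linearCombination_apply, mul_comm] using this
    obtain ⟨φ, hφ⟩ := exists_comp_eq_of_surjective s hs _ hker
    have hφv : φ (s v) = ∑ i, v i * r i := LinearMap.congr_fun hφ v
    simpa only [hφv, Finset.sum_smul, mul_comm (v _), mul_smul] using h φ
  obtain ⟨w, hw⟩ := exists_eq_sum_smul_of_consistent _ _ hconsistent
  have hvanish : TensorProduct.VanishesTrivially R (fun i ↦ s (Pi.single i 1)) fun i ↦ v i • z := by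
    refine ⟨k, _, w, hw, fun j ↦ ?_⟩
    have : a j ∈ LinearMap.ker s := ha ▸ Submodule.subset_span ⟨j, rfl⟩
    exact (hs_sum (a j)).symm.trans this
  calc s v ⊗ₜ[R] z = ∑ i, s (Pi.single i 1) ⊗ₜ[R] (v i • z) := by
        simp only [hs_sum v, TensorProduct.sum_tmul, TensorProduct.smul_tmul]
    _ = 0 := TensorProduct.sum_tmul_eq_zero_of_vanishesTrivially R hvanish

end InjectiveModule

section ResidueHull

variable {R : Type u} [CommRing R]

instance (M : Type u) [AddCommGroup M] [Module R M] : Module.Injective R (InjHull R M) :=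
  (InjHull.isInjectiveHull R M).injective_module

theorem tmul_residueHull_eq_zero_of_forall_dual_smul_eq_zero {M : Type*} [AddCommGroup M]
    [Module R M] [Module.FinitePresentation R M] (m : M) (z : ResidueHull R)
    (h : ∀ φ : M →ₗ[R] R, φ m • z = 0) : m ⊗ₜ[R] z = 0 := by
  classical
  rw [← DirectSum.sum_support_of z, TensorProduct.tmul_sum]
  refine Finset.sum_eq_zero fun 𝔪 _ ↦ ?_
  have hcomponent : m ⊗ₜ[R] z 𝔪 = 0 :=
    tmul_eq_zero_of_forall_dual_smul_eq_zero m (z 𝔪) fun φ ↦ DFunLike.congr_fun (h φ) 𝔪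
  let incl := DirectSum.lof R _ (fun 𝔪 : MaximalSpectrum R ↦ InjHull R (R ⧸ 𝔪.asIdeal)) 𝔪
  exact (congrArg (incl.lTensor M) hcomponent).trans (map_zero _)

theorem exists_linearMap_residueHull_ne_zero {N : Type*} [AddCommGroup N] [Module R N] {x : N}
    (hx : x ≠ 0) : ∃ f : N →ₗ[R] ResidueHull R, f x ≠ 0 := by
  classical
  have hker : LinearMap.ker (LinearMap.toSpanSingleton R N x) ≠ ⊤ := by
    rwa [Ne, Ideal.eq_top_iff_one, LinearMap.mem_ker, LinearMap.toSpanSingleton_apply, one_smul]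
  obtain ⟨𝔪, h𝔪, hle⟩ := Ideal.exists_le_maximal _ hker
  have hι := (InjHull.isInjectiveHull R (R ⧸ 𝔪)).injective_map
  obtain ⟨f, hf⟩ := exists_comp_eq_of_ker_le (LinearMap.toSpanSingleton R N x)
    (InjHull.ι R (R ⧸ 𝔪) ∘ₗ 𝔪.mkQ) (hle.trans (𝔪.ker_mkQ.ge.trans (LinearMap.ker_le_ker_comp _ _)))
  have hfx : f x = InjHull.ι R (R ⧸ 𝔪) 1 := by simpa using LinearMap.congr_fun hf 1
  have := Ideal.Quotient.nontrivial_iff.2 h𝔪.ne_top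
  refine ⟨DirectSum.lof R (MaximalSpectrum R) (fun 𝔫 ↦ InjHull R (R ⧸ 𝔫.asIdeal)) ⟨𝔪, h𝔪⟩ ∘ₗ f, ?_⟩
  rw [LinearMap.comp_apply, hfx]
  exact fun h ↦ one_ne_zero <| hι <|
    (DirectSum.of_injective (β := fun 𝔫 : MaximalSpectrum R ↦ InjHull R (R ⧸ 𝔫.asIdeal)) ⟨𝔪, h𝔪⟩
      (h.trans (map_zero _).symm)).trans (map_zero _).symm

theorem exists_le_torsionOf_residueHull (I : Ideal R) {r : R} (hr : r ∉ I) :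
    ∃ z : ResidueHull R, I ≤ Ideal.torsionOf R _ z ∧ r ∉ Ideal.torsionOf R _ z := by
  have hr' : Ideal.Quotient.mk I r ≠ 0 := mt Ideal.Quotient.eq_zero_iff_mem.1 hr
  obtain ⟨f, hf⟩ := exists_linearMap_residueHull_ne_zero (R := R) hr'
  have hsmul (y : R) : y • f 1 = f (Ideal.Quotient.mk I y) := by
    rw [← map_smul, Algebra.smul_def, mul_one, Ideal.Quotient.algebraMap_eq]
  refine ⟨f 1, fun y hy ↦ ?_, (hsmul r).trans_ne hf⟩
  rw [Ideal.mem_torsionOf_iff, hsmul, Ideal.Quotient.eq_zero_iff_mem.2 hy, map_zero]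

end ResidueHull

section CartierImage

variable {R : Type u} [CommRing R] {p : ℕ} [Fact p.Prime] [CharP R p]

theorem smul_toFrob (e : ℕ) (r x : R) : r • toFrob R p e x = toFrob R p e (r ^ p ^ e * x) := by
  rw [Algebra.smul_def, algebraMap_frobeniusRing, map_mul]

theorem map_iterateFrobenius_le_pow (e : ℕ) (I : Ideal R) :
    I.map (iterateFrobenius R p e) ≤ I ^ p ^ e :=
  Ideal.map_le_iff_le_comap.2 fun _ hx ↦ Ideal.pow_mem_pow hx _

theorem map_iterateFrobenius_le (e : ℕ) (I : Ideal R) : I.map (iterateFrobenius R p e) ≤ I :=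
  (map_iterateFrobenius_le_pow e I).trans
    (Ideal.pow_le_self (pow_ne_zero e (Fact.out : p.Prime).ne_zero))

/-- An `R`-linear map `ᶠR → R` read as a `p⁻ᶠ`-linear map `R → R` and followed by a `p⁻ᵉ`-linear
one is again an `R`-linear map `ᵉ⁺ᶠR → R`. -/
noncomputable def cartierComp {e f : ℕ} (φ : FrobeniusRing R p e →ₗ[R] R)
    (ψ : FrobeniusRing R p f →ₗ[R] R) : FrobeniusRing R p (e + f) →ₗ[R] R where
  toFun x := φ (toFrob R p e (ψ (toFrob R p f ((toFrob R p (e + f)).symm x))))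
  map_add' x y := by simp only [map_add]
  map_smul' r x := by
    obtain ⟨x, rfl⟩ := (toFrob R p (e + f)).surjective x
    rw [smul_toFrob, RingEquiv.symm_apply_apply, RingEquiv.symm_apply_apply, pow_add, pow_mul,
      ← smul_toFrob, map_smul, smul_eq_mul, ← smul_toFrob, map_smul, RingHom.id_apply]

/-- The ideal generated by the values on `I` of all `R`-linear maps `ᵉR → R`, that is, the image of
`I` under the `p⁻ᵉ`-linear maps of `R`. -/
def cartierImage (p : ℕ) [Fact p.Prime] [CharP R p] (e : ℕ) (I : Ideal R) : Ideal R :=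
  Ideal.span {y | ∃ φ : FrobeniusRing R p e →ₗ[R] R, ∃ x ∈ I, φ (toFrob R p e x) = y}

theorem apply_mem_cartierImage {e : ℕ} {I : Ideal R} (φ : FrobeniusRing R p e →ₗ[R] R) {x : R}
    (hx : x ∈ I) : φ (toFrob R p e x) ∈ cartierImage p e I :=
  Ideal.subset_span ⟨φ, x, hx, rfl⟩

theorem cartierImage_le {e : ℕ} {I K : Ideal R} :
    cartierImage p e I ≤ K ↔
      ∀ φ : FrobeniusRing R p e →ₗ[R] R, ∀ x ∈ I, φ (toFrob R p e x) ∈ K := by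
  refine ⟨fun h φ x hx ↦ h (apply_mem_cartierImage φ hx), fun h ↦ Ideal.span_le.2 ?_⟩
  rintro _ ⟨φ, x, hx, rfl⟩
  exact h φ x hx

theorem cartierImage_mono {e : ℕ} {I K : Ideal R} (h : I ≤ K) :
    cartierImage p e I ≤ cartierImage p e K :=
  cartierImage_le.2 fun φ _ hx ↦ apply_mem_cartierImage φ (h hx)

theorem cartierImage_iSup {ι : Sort*} (e : ℕ) (I : ι → Ideal R) :
    cartierImage p e (⨆ i, I i) = ⨆ i, cartierImage p e (I i) := by
  refine le_antisymm (cartierImage_le.2 fun φ x hx ↦ ?_)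
    (iSup_le fun i ↦ cartierImage_mono (le_iSup I i))
  induction hx using Submodule.iSup_induction' with
  | mem i x hx => exact Ideal.mem_iSup_of_mem i (apply_mem_cartierImage φ hx)
  | zero => simp
  | add x y _ _ hx hy => simpa only [map_add] using add_mem hx hy

theorem le_cartierImage_zero (I : Ideal R) : I ≤ cartierImage p 0 I := by
  intro x hx
  let φ : FrobeniusRing R p 0 →ₗ[R] R :=
    { toFun := (toFrob R p 0).symm
      map_add' := map_add _
      map_smul' := fun r y ↦ by
        obtain ⟨y, rfl⟩ := (toFrob R p 0).surjective y
        simp [smul_toFrob] }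
  exact apply_mem_cartierImage φ hx

theorem mul_cartierImage_le (e : ℕ) (I K : Ideal R) :
    I * cartierImage p e K ≤ cartierImage p e (I.map (iterateFrobenius R p e) * K) := by
  refine Ideal.mul_le.2 fun r hr y hy ↦ ?_
  suffices h : cartierImage p e K ≤
      Submodule.comap (LinearMap.mulLeft R r)
        (cartierImage p e (I.map (iterateFrobenius R p e) * K)) from h hy
  refine cartierImage_le.2 fun φ x hx ↦ ?_
  have hφ : r * φ (toFrob R p e x) = φ (toFrob R p e (r ^ p ^ e * x)) := by
    rw [← smul_toFrob, map_smul, smul_eq_mul]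
  rw [Submodule.mem_comap, LinearMap.mulLeft_apply, hφ]
  exact apply_mem_cartierImage φ (Ideal.mul_mem_mul (Ideal.mem_map_of_mem _ hr) hx)

theorem cartierImage_cartierImage_le (e f : ℕ) (I : Ideal R) :
    cartierImage p e (cartierImage p f I) ≤ cartierImage p (e + f) I := by
  refine cartierImage_le.2 fun φ y hy ↦ ?_
  induction hy using Submodule.span_induction generalizing φ with
  | mem y hy =>
    obtain ⟨ψ, x, hx, rfl⟩ := hy
    exact apply_mem_cartierImage (cartierComp φ ψ) hx
  | zero => simp
  | add y z _ _ hy hz => simpa only [map_add] using add_mem (hy φ) (hz φ)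
  | smul a y _ hy =>
    simpa using hy (φ ∘ₗ LinearMap.mulLeft R (toFrob R p e a))

end CartierImage

section Annihilator

variable {R : Type u} [CommRing R] {p : ℕ} [Fact p.Prime] [CharP R p]

theorem finite_iterateFrobenius (hF : IsFFinite R p) (e : ℕ) :
    (iterateFrobenius R p e).Finite := by
  induction e with
  | zero => simpa only [iterateFrobenius_zero] using RingHom.Finite.id R
  | succ e ih =>
    rw [iterateFrobenius_add, iterateFrobenius_one]
    exact ih.comp hF

theorem finitePresentation_frobeniusRing [IsNoetherianRing R] (hF : IsFFinite R p) (e : ℕ) :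
    Module.FinitePresentation R (FrobeniusRing R p e) :=
  have : Module.Finite R (FrobeniusRing R p e) := finite_iterateFrobenius hF e
  Module.finitePresentation_of_finite R _

theorem mulPow_eq_zero_iff [IsNoetherianRing R] (hF : IsFFinite R p) {e : ℕ} {x : R}
    {z : ResidueHull R} : mulPow R p e x z = 0 ↔
      ∀ φ : FrobeniusRing R p e →ₗ[R] R, φ (toFrob R p e x) • z = 0 := by
  have := finitePresentation_frobeniusRing hF e
  rw [mulPow_eq]
  refine ⟨fun h φ ↦ ?_, tmul_residueHull_eq_zero_of_forall_dual_smul_eq_zero _ z⟩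
  simpa using congrArg (TensorProduct.lift (LinearMap.lsmul R (ResidueHull R) ∘ₗ φ)) h

/-- The ideal `∑_{e ≥ e₀} 𝒞ₑ(d J_e)`, where `𝒞ₑ` is the image under all `p⁻ᵉ`-linear maps. Its
annihilator in `⨁ E_R(R/𝔪)` consists of the `z` with `d J_e z^q = 0` for all `q = pᵉ`, `e ≥ e₀`. -/
def cartierSum (p : ℕ) [Fact p.Prime] [CharP R p] (J : ℕ → Ideal R) (d : R) (e₀ : ℕ) : Ideal R :=
  ⨆ e ≥ e₀, cartierImage p e (Ideal.span {d} * J e)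

theorem mem_zeroTightClosure_iff [IsNoetherianRing R] (hF : IsFFinite R p) {J : ℕ → Ideal R}
    {z : ResidueHull R} : z ∈ zeroTightClosure R p J (ResidueHull R) ↔
      ∃ d ∈ ringCirc R, ∃ e₀, cartierSum p J d e₀ ≤ Ideal.torsionOf R _ z := by
  refine exists_congr fun d ↦ and_congr_right fun _ ↦ exists_congr fun e₀ ↦ ?_
  simp only [cartierSum, iSup_le_iff, cartierImage_le, Ideal.mem_torsionOf_iff,
    Ideal.mem_span_singleton_mul, forall_exists_index, and_imp, mulPow_eq_zero_iff hF]
  exact forall₂_congr fun e _ ↦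
    ⟨fun h φ _ x hx hdx ↦ hdx ▸ h x hx φ, fun h x hx φ ↦ h φ _ x hx rfl⟩

theorem mem_annihilator_zeroTightClosure_iff [IsNoetherianRing R] (hF : IsFFinite R p)
    {J : ℕ → Ideal R} {r : R} : r ∈ (zeroTightClosure R p J (ResidueHull R)).annihilator ↔
      ∀ d ∈ ringCirc R, ∀ e₀, r ∈ cartierSum p J d e₀ := by
  simp only [Submodule.mem_annihilator, mem_zeroTightClosure_iff hF]
  constructor
  · intro h d hd e₀
    by_contra hr
    obtain ⟨z, hz, hrz⟩ := exists_le_torsionOf_residueHull _ hr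
    exact hrz (h z ⟨d, hd, e₀, hz⟩)
  · rintro h z ⟨d, hd, e₀, hz⟩
    exact hz (h d hd e₀)

theorem annihilator_zeroTightClosure_le_iSup [IsNoetherianRing R] (hF : IsFFinite R p)
    {J : ℕ → Ideal R} {c : R} (hc : c ∈ ringCirc R) :
    (zeroTightClosure R p J (ResidueHull R)).annihilator ≤
      ⨆ e, cartierImage p e (Ideal.span {c} * J e) := by
  intro a ha
  have hle : cartierSum p J c 0 ≤ ⨆ e, cartierImage p e (Ideal.span {c} * J e) :=
    iSup₂_le fun e _ ↦ le_iSup (fun e ↦ cartierImage p e (Ideal.span {c} * J e)) e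
  exact hle ((mem_annihilator_zeroTightClosure_iff hF).1 ha c hc 0)

end Annihilator

section KrullIntersection

variable {R : Type*} [CommRing R] [IsNoetherianRing R]

theorem eq_top_of_forall_mem_pow {J : Ideal R} {d : R} (hd : d ∈ nonZeroDivisors R)
    (h : ∀ i : ℕ, d ∈ J ^ i) : J = ⊤ := by
  obtain ⟨r, hr⟩ := (J.mem_iInf_smul_pow_eq_bot_iff d).1 (by simpa [Submodule.mem_iInf] using h)
  have hr1 : (r : R) = 1 := by
    refine sub_eq_zero.1 ((mem_nonZeroDivisors_iff_right.1 hd) _ ?_)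
    rw [sub_mul, one_mul, ← smul_eq_mul, hr, sub_self]
  exact (Ideal.eq_top_iff_one J).2 (hr1 ▸ r.2)

theorem exists_pow_mem_of_forall_exists_mul_mem_pow {c d : R} (hd : d ∈ nonZeroDivisors R)
    (I : ℕ → Ideal R) (hI : ∀ e, Ideal.span {c} * I e ≤ I (e + 1))
    (hpow : ∀ e, ∃ n, c ^ n * d ∈ I e ^ e) : ∃ n e, c ^ n ∈ I e := by
  let A := Localization.Away c
  have hmem (K : Ideal R) (x : R) :
      algebraMap R A x ∈ K.map (algebraMap R A) ↔ ∃ n, c ^ n * x ∈ K := by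
    simp [IsLocalization.algebraMap_mem_map_algebraMap_iff (Submonoid.powers c),
      Submonoid.mem_powers_iff]
  have hmono : Monotone fun e ↦ (I e).map (algebraMap R A) := by
    refine monotone_nat_of_le_succ fun e ↦ Ideal.map_le_iff_le_comap.2 fun y hy ↦ ?_
    refine (hmem _ y).2 ⟨1, hI e ?_⟩
    rw [pow_one]
    exact Ideal.mul_mem_mul (Ideal.mem_span_singleton_self c) hy
  have : IsNoetherianRing A := IsLocalization.isNoetherianRing (Submonoid.powers c) A inferInstance
  obtain ⟨m, hm⟩ := monotone_stabilizes_iff_noetherian.2 ‹IsNoetherianRing A› ⟨_, hmono⟩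
  have hd' : algebraMap R A d ∈ nonZeroDivisors A :=
    IsLocalization.map_nonZeroDivisors_le (Submonoid.powers c) A (Submonoid.mem_map_of_mem _ hd)
  have htop : (I m).map (algebraMap R A) = ⊤ := by
    refine eq_top_of_forall_mem_pow hd' fun i ↦ ?_
    have hmi : (I m).map (algebraMap R A) = (I (max m i)).map (algebraMap R A) :=
      hm _ (le_max_left m i)
    rw [hmi]
    refine Ideal.pow_le_pow_right (le_max_right m i) ?_
    rw [← Ideal.map_pow]
    exact (hmem _ d).2 (hpow _)
  obtain ⟨n, hn⟩ := (hmem (I m) 1).1 (htop ▸ Submodule.mem_top)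
  exact ⟨n, m, by simpa using hn⟩

end KrullIntersection

section TestElement

variable {R : Type u} [CommRing R] {p : ℕ} [Fact p.Prime] [CharP R p]

theorem exists_span_mul_le_map_cartierImage [IsNoetherianRing R] [IsReduced R]
    (hF : IsFFinite R p) (e : ℕ) : ∃ c ∈ ringCirc R, ∀ I : Ideal R,
      Ideal.span {c} * I ≤ (cartierImage p e I).map (iterateFrobenius R p e) := by
  have := finitePresentation_frobeniusRing hF e
  obtain ⟨c, hc, n, v, φ, hv⟩ := exists_dualBasis_up_to_ringCirc (R := R) (FrobeniusRing R p e)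
  refine ⟨c ^ p ^ e, pow_mem hc _, fun I ↦ Ideal.span_singleton_mul_le_iff.2 fun x hx ↦ ?_⟩
  have hsum : c ^ p ^ e * x =
      ∑ i, φ i (toFrob R p e x) ^ p ^ e * (toFrob R p e).symm (v i) := by
    apply (toFrob R p e).injective
    simpa [← smul_toFrob] using hv (toFrob R p e x)
  rw [hsum]
  exact Ideal.sum_mem _ fun i _ ↦
    Ideal.mul_mem_right _ _ (Ideal.mem_map_of_mem _ (apply_mem_cartierImage (φ i) hx))

theorem exists_span_pow_mul_le_map_cartierImage {c : R} (hc : ∀ I : Ideal R,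
      Ideal.span {c} * I ≤ (cartierImage p 1 I).map (iterateFrobenius R p 1)) (e : ℕ) :
    ∃ n, ∀ I : Ideal R,
      Ideal.span {c ^ n} * I ≤ (cartierImage p e I).map (iterateFrobenius R p e) := by
  induction e with
  | zero =>
    refine ⟨0, fun I ↦ Ideal.mul_le_right.trans ?_⟩
    rw [iterateFrobenius_zero, Ideal.map_id]
    exact le_cartierImage_zero I
  | succ e ih =>
    obtain ⟨n, hn⟩ := ih
    refine ⟨n * p + 1, fun I ↦ ?_⟩
    calc Ideal.span {c ^ (n * p + 1)} * I
        = (Ideal.span {c ^ n}).map (iterateFrobenius R p 1) * (Ideal.span {c} * I) := by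
          rw [Ideal.map_span, Set.image_singleton, ← mul_assoc,
            Ideal.span_singleton_mul_span_singleton, iterateFrobenius_def, pow_one, ← pow_mul,
            ← pow_succ]
      _ ≤ (Ideal.span {c ^ n}).map (iterateFrobenius R p 1) *
            (cartierImage p 1 I).map (iterateFrobenius R p 1) := Ideal.mul_mono_right (hc I)
      _ = (Ideal.span {c ^ n} * cartierImage p 1 I).map (iterateFrobenius R p 1) :=
          (Ideal.map_mul _ _ _).symm
      _ ≤ ((cartierImage p e (cartierImage p 1 I)).map (iterateFrobenius R p e)).map
            (iterateFrobenius R p 1) := Ideal.map_mono (hn _)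
      _ = (cartierImage p e (cartierImage p 1 I)).map (iterateFrobenius R p (e + 1)) := by
          rw [Ideal.map_map, ← iterateFrobenius_add, add_comm]
      _ ≤ (cartierImage p (e + 1) I).map (iterateFrobenius R p (e + 1)) :=
          Ideal.map_mono (cartierImage_cartierImage_le e 1 I)

theorem mul_mem_cartierImage_span_pow {e n : ℕ} {x y : R} (hn : n ≤ p ^ e)
    (hy : y ∈ cartierImage p e ⊤) : x * y ∈ cartierImage p e (Ideal.span {x ^ n}) := by
  refine (mul_cartierImage_le e (Ideal.span {x}) ⊤).trans (cartierImage_mono ?_)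
    (Ideal.mul_mem_mul (Ideal.mem_span_singleton_self x) hy)
  rw [Ideal.mul_top, Ideal.map_span, Set.image_singleton, iterateFrobenius_def]
  exact Ideal.span_singleton_le_span_singleton.2 (pow_dvd_pow x hn)

theorem exists_pow_mem_cartierImage [IsNoetherianRing R] {c d : R} (hd : d ∈ nonZeroDivisors R)
    (hc : ∀ I : Ideal R,
      Ideal.span {c} * I ≤ (cartierImage p 1 I).map (iterateFrobenius R p 1)) :
    ∃ n e, c ^ n ∈ cartierImage p e (Ideal.span {d}) := by
  refine exists_pow_mem_of_forall_exists_mul_mem_pow hd _ (fun e ↦ ?_) fun e ↦ ?_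
  · calc Ideal.span {c} * cartierImage p e (Ideal.span {d})
        ≤ cartierImage p 1 (cartierImage p e (Ideal.span {d})) :=
          (hc _).trans (map_iterateFrobenius_le 1 _)
      _ ≤ cartierImage p (e + 1) (Ideal.span {d}) :=
          add_comm 1 e ▸ cartierImage_cartierImage_le 1 e _
  · obtain ⟨n, hn⟩ := exists_span_pow_mul_le_map_cartierImage hc e
    have he : e ≤ p ^ e := (Nat.lt_pow_self (Fact.out : p.Prime).one_lt).le
    exact ⟨n, (hn _).trans ((map_iterateFrobenius_le_pow e _).trans (Ideal.pow_le_pow_right he))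
      (Ideal.mul_mem_mul (Ideal.mem_span_singleton_self _) (Ideal.mem_span_singleton_self d))⟩

/-- A test element in terms of `p⁻ᵉ`-linear maps: an element of `R°` that lies, for every `d ∈ R°`,
in the image of `dR` under the `p⁻ᵉ`-linear maps for arbitrarily large `e`. -/
structure IsCartierTestElement (p : ℕ) [Fact p.Prime] [CharP R p] (c : R) : Prop where
  mem_ringCirc : c ∈ ringCirc R
  exists_mem_cartierImage : ∀ d ∈ ringCirc R, ∀ e₀, ∃ e ≥ e₀, c ∈ cartierImage p e (Ideal.span {d})

theorem exists_isCartierTestElement [IsNoetherianRing R] [IsReduced R] (hF : IsFFinite R p) :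
    ∃ c : R, IsCartierTestElement p c := by
  obtain ⟨c, hcR, hc⟩ := exists_span_mul_le_map_cartierImage hF 1
  have hp : p.Prime := Fact.out
  have hc_top : c ∈ cartierImage p 1 ⊤ := by
    simpa using (hc ⊤).trans (map_iterateFrobenius_le 1 _)
  have hsq (e : ℕ) : c * c ∈ cartierImage p e ⊤ := by
    induction e with
    | zero => exact le_cartierImage_zero _ Submodule.mem_top
    | succ e ih =>
      have hspan : Ideal.span {c ^ 2} ≤ cartierImage p e ⊤ := by
        rwa [pow_two, Ideal.span_singleton_le_iff_mem]
      rw [add_comm]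
      exact cartierImage_cartierImage_le 1 e ⊤ (cartierImage_mono hspan
        (mul_mem_cartierImage_span_pow (hp.two_le.trans_eq (pow_one p).symm) hc_top))
  refine ⟨c * (c * c), mul_mem hcR (mul_mem hcR hcR), fun d hd e₀ ↦ ?_⟩
  obtain ⟨n, e, hn⟩ := exists_pow_mem_cartierImage (ringCirc_le_nonZeroDivisors hd) hc
  have hle : n ≤ p ^ max e₀ n := (le_max_right e₀ n).trans (Nat.lt_pow_self hp.one_lt).le
  refine ⟨max e₀ n + e, (le_max_left e₀ n).trans (Nat.le_add_right _ _), ?_⟩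
  exact cartierImage_cartierImage_le _ e _ (cartierImage_mono
    ((Ideal.span_singleton_le_iff_mem _).2 hn) (mul_mem_cartierImage_span_pow hle (hsq _)))

theorem IsCartierTestElement.cartierImage_le_annihilator [IsNoetherianRing R] {c : R}
    (hc : IsCartierTestElement p c) (hF : IsFFinite R p) {J : ℕ → Ideal R} {v : R}
    (hv : v ∈ ringCirc R) {e : ℕ} {I : Ideal R}
    (h : ∀ f, Ideal.span {v} * I.map (iterateFrobenius R p f) ≤ J (e + f)) :
    cartierImage p e (Ideal.span {c} * I) ≤
      (zeroTightClosure R p J (ResidueHull R)).annihilator := by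
  refine fun a ha ↦ (mem_annihilator_zeroTightClosure_iff hF).2 fun d hd e₀ ↦ ?_
  obtain ⟨f, hf, hcf⟩ := hc.exists_mem_cartierImage (d * v) (mul_mem hd hv) e₀
  have hle : cartierImage p e (Ideal.span {c} * I) ≤ cartierSum p J d e₀ :=
    calc cartierImage p e (Ideal.span {c} * I)
        ≤ cartierImage p e (I * cartierImage p f (Ideal.span {d * v})) := by
          rw [mul_comm]
          exact cartierImage_mono
            (Ideal.mul_mono_right ((Ideal.span_singleton_le_iff_mem _).2 hcf))
      _ ≤ cartierImage p e (cartierImage p f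
            (I.map (iterateFrobenius R p f) * Ideal.span {d * v})) :=
          cartierImage_mono (mul_cartierImage_le f I _)
      _ ≤ cartierImage p (e + f) (I.map (iterateFrobenius R p f) * Ideal.span {d * v}) :=
          cartierImage_cartierImage_le e f _
      _ ≤ cartierImage p (e + f) (Ideal.span {d} * J (e + f)) := by
          rw [mul_comm, ← Ideal.span_singleton_mul_span_singleton, mul_assoc]
          exact cartierImage_mono (Ideal.mul_mono_right (h f))
      _ ≤ cartierSum p J d e₀ := le_iSup₂_of_le (e + f) (hf.trans (Nat.le_add_left f e)) le_rfl
  exact hle ha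

end TestElement

namespace GradedFamily

variable {R : Type u} [CommRing R] (𝔞 𝔟 : GradedFamily R)

theorem pow_mem_ideal {m : ℕ} {y : R} (hy : y ∈ 𝔞.ideal m) (j : ℕ) : y ^ j ∈ 𝔞.ideal (m * j) := by
  induction j with
  | zero => simp only [mul_zero, ideal_zero, Submodule.mem_top]
  | succ j ih =>
    rw [pow_succ, mul_add_one]
    exact 𝔞.mul_le' _ _ (Ideal.mul_mem_mul ih hy)

theorem pow_mul_pow_mem_ideal {u y : R} {m n Q : ℕ} (hu : u ∈ 𝔞.ideal 1)
    (hy : y ∈ 𝔞.ideal m) (h : n ≤ m * Q) : u ^ m * y ^ Q ∈ 𝔞.ideal n := by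
  rcases Nat.eq_zero_or_pos m with rfl | hm
  · obtain rfl : n = 0 := by simpa only [zero_mul, Nat.le_zero] using h
    simp only [ideal_zero, Submodule.mem_top]
  -- `n` need not be a multiple of `m`; the factor `u ^ m` absorbs the remainder.
  have hmod : u ^ (n % m) * y ^ (n / m) ∈ 𝔞.ideal n := by
    have := 𝔞.mul_le' _ _ (Ideal.mul_mem_mul (𝔞.pow_mem_ideal hu (n % m))
      (𝔞.pow_mem_ideal hy (n / m)))
    rwa [one_mul, Nat.mod_add_div] at this
  exact Ideal.mem_of_dvd _ (mul_dvd_mul (pow_dvd_pow u (Nat.mod_lt n hm).le)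
    (pow_dvd_pow y (Nat.div_le_of_le_mul h))) hmod

theorem exists_span_mul_map_iterateFrobenius_le {p : ℕ} [Fact p.Prime] [CharP R p] {t : ℝ}
    {e m : ℕ} (h : t * (p : ℝ) ^ e ≤ m) : ∃ v ∈ ringCirc R, ∀ f, Ideal.span {v} *
      (𝔞.ideal m).map (iterateFrobenius R p f) ≤ 𝔞.ideal ⌈t * (p : ℝ) ^ (e + f)⌉₊ := by
  obtain ⟨u, hu, huR⟩ := 𝔞.exists_mem_one
  refine ⟨u ^ m, pow_mem huR m, fun f ↦ ?_⟩
  have hceil : ⌈t * (p : ℝ) ^ (e + f)⌉₊ ≤ m * p ^ f := by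
    rw [Nat.ceil_le, pow_add, ← mul_assoc]
    push_cast
    gcongr
  rw [Ideal.map, Ideal.span_mul_span', Ideal.span_le]
  rintro _ ⟨_, rfl, _, ⟨y, hy, rfl⟩, rfl⟩
  exact 𝔞.pow_mul_pow_mem_ideal hu hy hceil

theorem add_ideal_eq_iSup (m : ℕ) : (𝔞 + 𝔟).ideal m =
    ⨆ kl ∈ Finset.HasAntidiagonal.antidiagonal m, 𝔞.ideal kl.1 * 𝔟.ideal kl.2 := by
  rw [add_ideal, Ideal.sum_eq_sup, Finset.sup_eq_iSup]

theorem mul_le_add_ideal (k l : ℕ) : 𝔞.ideal k * 𝔟.ideal l ≤ (𝔞 + 𝔟).ideal (k + l) := by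
  rw [add_ideal_eq_iSup]
  exact le_iSup₂_of_le (k, l) (Finset.HasAntidiagonal.mem_antidiagonal.2 rfl) le_rfl

end GradedFamily

theorem exists_add_eq_of_add_eq_ceil {t q : ℝ} (ht : 0 ≤ t) (hq : 0 < q) {k l : ℕ}
    (h : k + l = ⌈t * q⌉₊) :
    ∃ r s : ℝ, 0 ≤ r ∧ 0 ≤ s ∧ r + s = t ∧ r * q ≤ k ∧ s * q ≤ l := by
  have hkl : t * q ≤ k + l := by exact_mod_cast h ▸ Nat.le_ceil (t * q)
  rcases le_total t (k / q) with htk | htk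
  · refine ⟨t, 0, ht, le_rfl, add_zero t, (le_div_iff₀ hq).1 htk, ?_⟩
    rw [zero_mul]
    positivity
  · refine ⟨k / q, t - k / q, by positivity, sub_nonneg.2 htk, add_sub_cancel _ _,
      (div_mul_cancel₀ _ hq.ne').le, ?_⟩
    rw [sub_mul, div_mul_cancel₀ _ hq.ne']
    linarith

theorem testIdeal_add_le_iSup {R : Type u} [CommRing R] [IsNoetherianRing R] {p : ℕ}
    [Fact p.Prime] [CharP R p] (hF : IsFFinite R p) {c : R} (hc : c ∈ ringCirc R)
    (𝔞 𝔟 : GradedFamily R) (t : ℝ) : testIdeal p (𝔞 + 𝔟) t ≤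
      ⨆ (e : ℕ) (kl ∈ Finset.HasAntidiagonal.antidiagonal ⌈t * (p : ℝ) ^ e⌉₊),
        cartierImage p e (Ideal.span {c} * (𝔞.ideal kl.1 * 𝔟.ideal kl.2)) := by
  refine (annihilator_zeroTightClosure_le_iSup hF hc).trans_eq ?_
  simp only [GradedFamily.add_ideal_eq_iSup, Ideal.mul_iSup, cartierImage_iSup]

namespace IsCartierTestElement

variable {R : Type u} [CommRing R] [IsNoetherianRing R] {p : ℕ} [Fact p.Prime] [CharP R p] {c : R}

theorem cartierImage_le_testIdeal (hc : IsCartierTestElement p c) (hF : IsFFinite R p)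
    (𝔞 : GradedFamily R) {t : ℝ} {e m : ℕ} (hm : t * (p : ℝ) ^ e ≤ m) :
    cartierImage p e (Ideal.span {c} * 𝔞.ideal m) ≤ testIdeal p 𝔞 t := by
  obtain ⟨v, hv, h⟩ := 𝔞.exists_span_mul_map_iterateFrobenius_le hm
  exact hc.cartierImage_le_annihilator hF hv h

theorem cartierImage_le_mixedTestIdeal (hc : IsCartierTestElement p c) (hF : IsFFinite R p)
    (𝔞 𝔟 : GradedFamily R) {s t : ℝ} {e k l : ℕ} (hk : s * (p : ℝ) ^ e ≤ k)
    (hl : t * (p : ℝ) ^ e ≤ l) :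
    cartierImage p e (Ideal.span {c} * (𝔞.ideal k * 𝔟.ideal l)) ≤ mixedTestIdeal p 𝔞 𝔟 s t := by
  obtain ⟨v, hv, hva⟩ := 𝔞.exists_span_mul_map_iterateFrobenius_le hk
  obtain ⟨w, hw, hwb⟩ := 𝔟.exists_span_mul_map_iterateFrobenius_le hl
  refine hc.cartierImage_le_annihilator hF (mul_mem hv hw) fun f ↦ ?_
  rw [← Ideal.span_singleton_mul_span_singleton, Ideal.map_mul, mul_mul_mul_comm]
  exact Ideal.mul_mono (hva f) (hwb f)

theorem mixedTestIdeal_le_testIdeal_add (hc : IsCartierTestElement p c) (hF : IsFFinite R p)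
    (𝔞 𝔟 : GradedFamily R) (s t : ℝ) :
    mixedTestIdeal p 𝔞 𝔟 s t ≤ testIdeal p (𝔞 + 𝔟) (s + t) := by
  refine (annihilator_zeroTightClosure_le_iSup hF hc.mem_ringCirc).trans (iSup_le fun e ↦ ?_)
  have hm : (s + t) * (p : ℝ) ^ e ≤ (⌈s * (p : ℝ) ^ e⌉₊ + ⌈t * (p : ℝ) ^ e⌉₊ : ℕ) := by
    rw [add_mul, Nat.cast_add]
    exact add_le_add (Nat.le_ceil _) (Nat.le_ceil _)
  exact (cartierImage_mono (Ideal.mul_mono_right (𝔞.mul_le_add_ideal 𝔟 _ _))).trans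
    (hc.cartierImage_le_testIdeal hF (𝔞 + 𝔟) hm)

end IsCartierTestElement

end AsymptoticTestIdeal

theorem proposition4p9 {R : Type u} [CommRing R] [IsNoetherianRing R] [IsReduced R]
    (p : ℕ) [Fact p.Prime] [CharP R p] (hF : AsymptoticTestIdeal.IsFFinite R p)
    (𝔞 𝔟 : AsymptoticTestIdeal.GradedFamily R) (t : ℝ) (ht : 0 < t) :
    AsymptoticTestIdeal.testIdeal p (𝔞 + 𝔟) t =
      ⨆ (l : ℝ) (m : ℝ) (_ : 0 ≤ l) (_ : 0 ≤ m) (_ : l + m = t),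
        AsymptoticTestIdeal.mixedTestIdeal p 𝔞 𝔟 l m := by
  obtain ⟨c, hc⟩ := AsymptoticTestIdeal.exists_isCartierTestElement hF
  apply le_antisymm
  · refine (AsymptoticTestIdeal.testIdeal_add_le_iSup hF hc.mem_ringCirc 𝔞 𝔟 t).trans
      (iSup_le fun e ↦ iSup₂_le fun kl hkl ↦ ?_)
    have hq : (0 : ℝ) < (p : ℝ) ^ e := pow_pos (Nat.cast_pos.2 (Fact.out : p.Prime).pos) e
    obtain ⟨r, s, hr, hs, hrs, hrk, hsl⟩ := AsymptoticTestIdeal.exists_add_eq_of_add_eq_ceil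
      ht.le hq (Finset.HasAntidiagonal.mem_antidiagonal.1 hkl)
    exact (hc.cartierImage_le_mixedTestIdeal hF 𝔞 𝔟 hrk hsl).trans
      (le_iSup₂_of_le r s (le_iSup₂_of_le hr hs (le_iSup_of_le hrs le_rfl)))
  · refine iSup₂_le fun r s ↦ iSup₂_le fun _ _ ↦ iSup_le fun hrs ↦ ?_
    exact hrs ▸ hc.mixedTestIdeal_le_testIdeal_add hF 𝔞 𝔟 r s
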